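/- Let $\mathcal{E}$ be a complex Banach space, let $M\ge 1$ and $\omega\ge 0$, and let $\{T(t)\}_{t\ge 0}$ be a $C_0$-semigroup of class $\mathcal{SG}(M,\omega)$ on $\mathcal{E}$: the $T(t)$ are bounded linear operators on $\mathcal{E}$ with $T(0)=I$, $T(t+s)=T(t)T(s)$ for all $t,s\ge 0$, $\lim_{t\searrow 0}T(t)x=x$ for every $x\in\mathcal{E}$, and $\|T(t)\|\le Me^{\omega t}$ for all $t\ge 0$. Let $A$ be its infinitesimal generator, $Ax=\lim_{t\searrow 0}\frac{T(t)x-x}{t}$, whose domain $\mathcal{D}(A)$ is the set of all $x$ for which this limit exists; let $\mathcal{D}(A^2)=\{x\in\mathcal{D}(A) : Ax\in\mathcal{D}(A)\}$; and, for $z$ in the resolvent set $\rho(A)$, let $R(z;A)=(zI-A)^{-1}$. Let $\lambda\in\mathbb{C}$ with $\operatorname{Re}\lambda>\omega$. Then the line $\{z : \operatorname{Re}z=\operatorname{Re}\lambda\}$ lies in $\rho(A)$, and for every $x\in\mathcal{D}(A^2)$ and every $t>0$ $$T(t)x=\frac{1}{2\pi i}\int_{\operatorname{Re}\lambda-i\infty}^{\operatorname{Re}\lambda+i\infty}e^{zt}R(z;A)x\,dz,$$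 where the integral is the convergent improper integral $\lim_{r,s\to+\infty}\int_{\operatorname{Re}\lambda-ir}^{\operatorname{Re}\lambda+is}$, the limit being taken as $r$ and $s$ tend to $+\infty$ independently. Moreover, for every $x\in\mathcal{D}(A^2)$ and every $\delta>0$, this improper integral converges uniformly for $t\in[\delta,1/\delta]$. -/

import Mathlib

open Filter Topology MeasureTheory Set

namespace C0Semigroup

variable {E : Type*} [NormedAddCommGroup E] [NormedSpace ℂ E]

/-- A family `(T t)` of bounded operators, indexed by `t ≥ 0`, is a `C₀`-semigroup. Only the values
`T t` with `0 ≤ t` are constrained; here and below the values at negative times are never used. -/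
structure IsC0Semigroup (T : ℝ → E →L[ℂ] E) : Prop where
  map_zero : T 0 = ContinuousLinearMap.id ℂ E
  map_add : ∀ t s : ℝ, 0 ≤ t → 0 ≤ s → T (t + s) = (T t).comp (T s)
  tendsto_zero : ∀ x : E, Tendsto (fun t : ℝ => T t x) (𝓝[>] 0) (𝓝 x)

/-- The class `SG(M, ω)` of `C₀`-semigroups with `‖T t‖ ≤ M e^{ωt}` for all `t ≥ 0`, where
`M ≥ 1` and `ω ≥ 0`. -/
structure IsSG (M ω : ℝ) (T : ℝ → E →L[ℂ] E) : Prop where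
  isC0Semigroup : IsC0Semigroup T
  one_le : 1 ≤ M
  nonneg : 0 ≤ ω
  norm_le : ∀ t : ℝ, 0 ≤ t → ‖T t‖ ≤ M * Real.exp (ω * t)

/-- `y = lim_{t ↘ 0} (T t x - x) / t`. -/
def HasRightDeriv (T : ℝ → E →L[ℂ] E) (x y : E) : Prop :=
  Tendsto (fun t : ℝ => ((t : ℂ)⁻¹) • (T t x - x)) (𝓝[>] 0) (𝓝 y)

theorem HasRightDeriv.add {T : ℝ → E →L[ℂ] E} {x y x' y' : E} (h : HasRightDeriv T x y)
    (h' : HasRightDeriv T x' y') : HasRightDeriv T (x + x') (y + y') := by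
  refine (Tendsto.add h h').congr fun t => ?_
  rw [← smul_add, (T t).map_add]
  congr 1
  abel

theorem HasRightDeriv.smul {T : ℝ → E →L[ℂ] E} {x y : E} (c : ℂ) (h : HasRightDeriv T x y) :
    HasRightDeriv T (c • x) (c • y) := by
  refine (Tendsto.const_smul h c).congr fun t => ?_
  rw [(T t).map_smul, ← smul_sub, smul_comm]

theorem hasRightDeriv_zero (T : ℝ → E →L[ℂ] E) : HasRightDeriv T 0 0 := by
  simp [HasRightDeriv]

theorem HasRightDeriv.unique {T : ℝ → E →L[ℂ] E} {x y y' : E} (h : HasRightDeriv T x y)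
    (h' : HasRightDeriv T x y') : y = y' :=
  tendsto_nhds_unique h h'

/-- The infinitesimal generator: its domain is the set of the `x` for which the limit
`lim_{t ↘ 0} (T t x - x) / t` exists, and it maps `x` to that limit. -/
noncomputable def generator (T : ℝ → E →L[ℂ] E) : E →ₗ.[ℂ] E where
  domain :=
    { carrier := {x | ∃ y, HasRightDeriv T x y}
      add_mem' := fun ⟨y, h⟩ ⟨y', h'⟩ => ⟨y + y', h.add h'⟩
      zero_mem' := ⟨0, hasRightDeriv_zero T⟩
      smul_mem' := fun c _ ⟨y, h⟩ => ⟨c • y, h.smul c⟩ }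
  toFun :=
    { toFun := fun x => Classical.choose x.2
      map_add' := fun x x' => HasRightDeriv.unique (Classical.choose_spec (x + x').2)
        ((Classical.choose_spec x.2).add (Classical.choose_spec x'.2))
      map_smul' := fun c x => HasRightDeriv.unique (Classical.choose_spec (c • x).2)
        ((Classical.choose_spec x.2).smul c) }

theorem mem_generator_domain {T : ℝ → E →L[ℂ] E} {x : E} :
    x ∈ (generator T).domain ↔ ∃ y, HasRightDeriv T x y :=
  Iff.rfl

theorem generator_spec {T : ℝ → E →L[ℂ] E} (x : (generator T).domain) :
    HasRightDeriv T x (generator T x) :=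
  Classical.choose_spec x.2

/-- The domain `D(A²) = {x ∈ D(A) | A x ∈ D(A)}`. -/
def sqDomain (A : E →ₗ.[ℂ] E) : Set E :=
  {x | ∃ h : x ∈ A.domain, A ⟨x, h⟩ ∈ A.domain}

/-- The bounded, everywhere defined operator `R` is a two-sided inverse of
`zI - A : D(A) → E`. -/
def IsResolventAt (A : E →ₗ.[ℂ] E) (z : ℂ) (R : E →L[ℂ] E) : Prop :=
  (∀ y : E, ∃ h : R y ∈ A.domain, z • R y - A ⟨R y, h⟩ = y) ∧
    ∀ x : A.domain, R (z • (x : E) - A x) = x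

theorem IsResolventAt.unique {A : E →ₗ.[ℂ] E} {z : ℂ} {R R' : E →L[ℂ] E}
    (h : IsResolventAt A z R) (h' : IsResolventAt A z R') : R = R' := by
  ext y
  obtain ⟨hy, e⟩ := h'.1 y
  simpa [e] using h.2 ⟨R' y, hy⟩

/-- The resolvent set `ρ(A)`. -/
def resolventSet (A : E →ₗ.[ℂ] E) : Set ℂ :=
  {z | ∃ R : E →L[ℂ] E, IsResolventAt A z R}

open Classical in
/-- The resolvent `R(z; A) = (zI - A)⁻¹` for `z ∈ ρ(A)` (and `0`, by convention, elsewhere). -/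
noncomputable def resolvent (A : E →ₗ.[ℂ] E) (z : ℂ) : E →L[ℂ] E :=
  if h : z ∈ resolventSet A then Classical.choose h else 0

theorem isResolventAt_resolvent {A : E →ₗ.[ℂ] E} {z : ℂ} (h : z ∈ resolventSet A) :
    IsResolventAt A z (resolvent A z) := by
  rw [resolvent, dif_pos h]
  exact Classical.choose_spec h

/-- The path integral `∫ f(z) dz` along the segment from `a + ir` to `a + is`. -/
noncomputable def segmentIntegral (f : ℂ → E) (a r s : ℝ) : E :=
  ∫ τ in r..s, Complex.I • f (a + τ * Complex.I)

/-- `f` is integrable along every bounded segment of the line `Re z = a`. -/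
def LocallyIntegrableOnLine (f : ℂ → E) (a : ℝ) : Prop :=
  ∀ r s : ℝ, IntervalIntegrable (fun τ : ℝ => f (a + τ * Complex.I)) volume r s

/-- The improper integral `∫_{a - i∞}^{a + i∞} f(z) dz` converges, with value `v`: the integrals
from `a - ir` to `a + is` tend to `v` as `r, s → +∞` independently. -/
def HasLineIntegral (f : ℂ → E) (a : ℝ) (v : E) : Prop :=
  LocallyIntegrableOnLine f a ∧
    Tendsto (fun p : ℝ × ℝ => segmentIntegral f a (-p.1) p.2) (atTop ×ˢ atTop) (𝓝 v)

/-- The improper integrals `∫_{a - i∞}^{a + i∞} f t z dz`, with values `v t`, converge uniformly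
for `t` in `S`. -/
def HasLineIntegralUniformlyOn (f : ℝ → ℂ → E) (a : ℝ) (v : ℝ → E) (S : Set ℝ) : Prop :=
  (∀ t ∈ S, LocallyIntegrableOnLine (f t) a) ∧
    TendstoUniformlyOn (fun (p : ℝ × ℝ) (t : ℝ) => segmentIntegral (f t) a (-p.1) p.2) v
      (atTop ×ˢ atTop) S

end C0Semigroup

/-! For `Re z > ω` the resolvent is the Laplace transform of the orbit, so the claim is a Laplace,
hence Fourier, inversion formula along `Re z = a`. The obstacle is that `R(z)x` decays only like
`1/z`, which is not integrable on the line. The slow part is split off: `R(z)x - x/z` is the Laplace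
transform of `T(s)x - x`, and using `R(z)u = (u + R(z)Au)/z` twice, which needs `x ∈ D(A²)`, it
equals `z⁻²(Ax + R(z)A²x)`. Since `R(z)` is bounded on the line, this is `O(|z|⁻²)`. Fourier
inversion (`integral_exp_smul_laplace`) then gives `2π(T(t)x - x)`, and the absolute convergence
makes the limit uniform for bounded `t` (`tendstoUniformlyOn_exp_smul`).

What remains is the scalar integral of `e^{zt}/z`, which converges only conditionally. Integration
by parts (`integral_exp_div_line`) turns it into `t⁻¹` times the absolutely convergent integral of
`e^{zt}/z²`, and inversion applied to the function `s` evaluates this as `2πt`. The factor `t⁻¹` is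
why uniformity requires `t` to stay away from `0`. Adding the two pieces cancels `x`. -/

namespace C0Semigroup

/-! ### The Laplace transform and its inversion. -/

variable {E : Type*} [NormedAddCommGroup E] [NormedSpace ℂ E]

/-- The Laplace transform `∫₀^∞ e^{-zs} f(s) ds`. -/
noncomputable def laplace (f : ℝ → E) (z : ℂ) : E :=
  ∫ s in Ioi (0 : ℝ), Complex.exp (-(z * s)) • f s

theorem norm_exp_neg_mul_ofReal (z : ℂ) (s : ℝ) :
    ‖Complex.exp (-(z * s))‖ = Real.exp (-(z.re * s)) := by
  simp [Complex.norm_exp]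

theorem norm_exp_neg_mul_smul_le {f : ℝ → E} {C b s : ℝ} (hs : ‖f s‖ ≤ C * Real.exp (b * s))
    (z : ℂ) :
    ‖Complex.exp (-(z * s)) • f s‖ ≤ C * Real.exp ((b - z.re) * s) := by
  rw [norm_smul, norm_exp_neg_mul_ofReal]
  calc Real.exp (-(z.re * s)) * ‖f s‖ ≤ Real.exp (-(z.re * s)) * (C * Real.exp (b * s)) := by gcongr
    _ = C * Real.exp ((b - z.re) * s) := by
      rw [mul_left_comm, ← Real.exp_add]; ring_nf

theorem integrableOn_laplace {f : ℝ → E} {C b : ℝ} {z : ℂ} (hf : ContinuousOn f (Ioi 0))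
    (hb : ∀ s, 0 < s → ‖f s‖ ≤ C * Real.exp (b * s)) (hz : b < z.re) :
    IntegrableOn (fun s : ℝ => Complex.exp (-(z * s)) • f s) (Ioi 0) := by
  refine Integrable.mono' ((integrableOn_exp_mul_Ioi (sub_neg.2 hz) 0).const_mul C) ?_ ?_
  · refine ContinuousOn.aestronglyMeasurable ?_ measurableSet_Ioi
    exact ContinuousOn.smul (by fun_prop) hf
  · refine (ae_restrict_mem measurableSet_Ioi).mono fun s hs => ?_
    exact norm_exp_neg_mul_smul_le (hb s hs) z

theorem norm_laplace_le {f : ℝ → E} {C b : ℝ} {z : ℂ}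
    (hb : ∀ s, 0 < s → ‖f s‖ ≤ C * Real.exp (b * s)) (hz : b < z.re) :
    ‖laplace f z‖ ≤ C / (z.re - b) := by
  refine (norm_integral_le_of_norm_le
    ((integrableOn_exp_mul_Ioi (sub_neg.2 hz) 0).const_mul C)
    ((ae_restrict_mem measurableSet_Ioi).mono fun s hs =>
      norm_exp_neg_mul_smul_le (hb s hs) z)).trans_eq ?_
  rw [integral_const_mul, integral_exp_mul_Ioi (sub_neg.2 hz)]
  rw [mul_zero, Real.exp_zero, neg_div, ← div_neg, neg_sub, mul_one_div]

theorem laplace_one {z : ℂ} (hz : 0 < z.re) : laplace (fun _ => (1 : ℂ)) z = z⁻¹ := by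
  have h := integral_exp_mul_complex_Ioi (a := -z) (by simpa using hz) 0
  simpa [laplace] using h

theorem norm_ofReal_le_exp {b s : ℝ} (hb : 0 < b) (hs : 0 < s) :
    ‖(s : ℂ)‖ ≤ b⁻¹ * Real.exp (b * s) := by
  rw [Complex.norm_real, Real.norm_of_nonneg hs.le, inv_mul_eq_div, le_div_iff₀ hb]
  linarith [Real.add_one_le_exp (b * s)]

theorem integrableOn_laplace_id {z : ℂ} (hz : 0 < z.re) :
    IntegrableOn (fun s : ℝ => Complex.exp (-(z * s)) • (s : ℂ)) (Ioi 0) :=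
  integrableOn_laplace (by fun_prop) (fun _ hs => norm_ofReal_le_exp (half_pos hz) hs)
    (half_lt_self hz)

theorem laplace_id {z : ℂ} (hz : 0 < z.re) : laplace (fun s => (s : ℂ)) z = (z ^ 2)⁻¹ := by
  have h0 : z ≠ 0 := by rintro rfl; simp at hz
  have h := integral_Ioi_of_hasDerivAt_of_tendsto (a := 0) (m := 0)
    -- An explicit antiderivative of `s e^{-zs}`; it vanishes at infinity because `Re z > 0`.
    (f := fun s : ℝ => -((s : ℂ) / z + (z ^ 2)⁻¹) * Complex.exp (-(z * s)))
    (f' := fun s : ℝ => Complex.exp (-(z * s)) • (s : ℂ)) (by fun_prop) (fun s _ => ?_)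
    (integrableOn_laplace_id hz) ?_
  · rw [laplace, h]; simp
  · have h1 : HasDerivAt (fun s : ℝ => (s : ℂ)) 1 s := Complex.ofRealCLM.hasDerivAt
    convert! (((h1.div_const z).add_const (z ^ 2)⁻¹).neg.mul (h1.const_mul z).neg.cexp) using 1
    simp only [smul_eq_mul, Pi.neg_apply]
    field_simp
    ring
  · have h1 : Tendsto (fun s : ℝ => s ^ 1 * Real.exp (-z.re * s)) atTop (𝓝 0) := by
      simpa using tendsto_rpow_mul_exp_neg_mul_atTop_nhds_zero 1 z.re hz
    have h2 : Tendsto (fun s : ℝ => s ^ 0 * Real.exp (-z.re * s)) atTop (𝓝 0) := by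
      simpa using tendsto_rpow_mul_exp_neg_mul_atTop_nhds_zero 0 z.re hz
    rw [tendsto_zero_iff_norm_tendsto_zero]
    refine squeeze_zero' (.of_forall fun _ => norm_nonneg _) ?_
      (g := fun s : ℝ => ‖z‖⁻¹ * (s ^ 1 * Real.exp (-z.re * s)) +
        ‖z ^ 2‖⁻¹ * (s ^ 0 * Real.exp (-z.re * s))) ?_
    · filter_upwards [eventually_ge_atTop 0] with s hs
      rw [norm_mul, norm_exp_neg_mul_ofReal, norm_neg, pow_one, pow_zero, ← neg_mul]
      have : ‖(s : ℂ) / z + (z ^ 2)⁻¹‖ ≤ ‖z‖⁻¹ * s + ‖z ^ 2‖⁻¹ := by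
        refine (norm_add_le _ _).trans_eq ?_
        rw [norm_div, norm_inv, Complex.norm_real, Real.norm_of_nonneg hs, div_eq_inv_mul]
      calc _ ≤ (‖z‖⁻¹ * s + ‖z ^ 2‖⁻¹) * Real.exp (-z.re * s) := by gcongr
        _ = _ := by ring
    · simpa only [mul_zero, add_zero] using (h1.const_mul ‖z‖⁻¹).add (h2.const_mul ‖z ^ 2‖⁻¹)

/-- Continuity of the Laplace transform along vertical lines. -/
theorem continuous_laplace_line {f : ℝ → E} {C b a : ℝ} (hf : ContinuousOn f (Ioi 0))
    (hb : ∀ s, 0 < s → ‖f s‖ ≤ C * Real.exp (b * s)) (ha : b < a) :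
    Continuous fun τ : ℝ => laplace f (a + τ * Complex.I) := by
  have hre (τ : ℝ) : ((a : ℂ) + τ * Complex.I).re = a := by simp
  refine continuous_of_dominated
    (bound := fun s => C * Real.exp ((b - a) * s)) (fun τ => ?_) (fun τ => ?_)
    ((integrableOn_exp_mul_Ioi (sub_neg.2 ha) 0).const_mul C) ?_
  · exact (integrableOn_laplace hf hb (by rwa [hre])).aestronglyMeasurable
  · refine (ae_restrict_mem measurableSet_Ioi).mono fun s hs => ?_
    simpa only [hre] using norm_exp_neg_mul_smul_le (hb s hs) (a + τ * Complex.I)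
  · exact .of_forall fun s => by fun_prop

open FourierTransform in
/-- Inversion of the Laplace transform along a line on which it is integrable. -/
theorem integral_exp_smul_laplace [CompleteSpace E] {f : ℝ → E} {C b a : ℝ}
    (hf : ContinuousOn f (Ioi 0)) (hb : ∀ s, 0 < s → ‖f s‖ ≤ C * Real.exp (b * s)) (ha : b < a)
    (hL : Integrable fun τ : ℝ => laplace f (a + τ * Complex.I)) {t : ℝ} (ht : 0 < t) :
    ∫ τ : ℝ, Complex.exp ((a + τ * Complex.I) * t) • laplace f (a + τ * Complex.I) =
      (2 * Real.pi : ℂ) • f t := by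
  -- The damped function, extended by zero to the negative axis, has as Fourier transform at `ξ` the
  -- Laplace transform at `a + 2πiξ`. It may jump at `0`, so pointwise inversion is used only at `t
  -- > 0`.
  set g : ℝ → E := indicator (Ioi 0) fun s : ℝ => Complex.exp (-((a : ℂ) * s)) • f s with hg
  have hgi : Integrable g :=
    (integrable_indicator_iff measurableSet_Ioi).2 (integrableOn_laplace hf hb (by simpa using ha))
  have hgc : ContinuousAt g t := by
    have : ContinuousAt (fun s : ℝ => Complex.exp (-((a : ℂ) * s)) • f s) t :=
      ContinuousAt.smul (by fun_prop) (hf.continuousAt (Ioi_mem_nhds ht))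
    refine this.congr ?_
    filter_upwards [Ioi_mem_nhds ht] with s hs
    rw [hg, indicator_of_mem hs]
  have hF (ξ : ℝ) : 𝓕 g ξ = laplace f (a + (2 * Real.pi * ξ : ℝ) * Complex.I) := by
    rw [Real.fourier_real_eq_integral_exp_smul, laplace, ← integral_indicator measurableSet_Ioi]
    congr 1
    ext s
    by_cases hs : s ∈ Ioi (0 : ℝ)
    · rw [hg, indicator_of_mem hs, indicator_of_mem hs, smul_smul, ← Complex.exp_add]
      congr 2
      push_cast
      ring
    · rw [hg, indicator_of_notMem hs, indicator_of_notMem hs, smul_zero]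
  have hpi : (2 * Real.pi) ≠ 0 := by positivity
  have hFi : Integrable (𝓕 g) := by
    have := hL.comp_mul_left' hpi
    exact this.congr (.of_forall fun ξ => (hF ξ).symm)
  have key := hgi.fourierInv_fourier_eq hFi hgc
  -- The substitution `τ = 2πξ` produces the factor `2π`.
  have hsub := Measure.integral_comp_mul_left
    (fun τ : ℝ => Complex.exp ((a + τ * Complex.I) * t) • laplace f (a + τ * Complex.I))
    (2 * Real.pi)
  have h2 : ∫ ξ : ℝ, Complex.exp ((a + (2 * Real.pi * ξ : ℝ) * Complex.I) * t) •
      laplace f (a + (2 * Real.pi * ξ : ℝ) * Complex.I) = f t := by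
    have hgt : g t = Complex.exp (-((a : ℂ) * t)) • f t := indicator_of_mem (mem_Ioi.2 ht) _
    rw [Real.fourierInv_eq', hgt] at key
    have : f t = Complex.exp (a * t) • Complex.exp (-((a : ℂ) * t)) • f t := by
      rw [smul_smul, ← Complex.exp_add]; simp
    rw [this, ← key, ← integral_smul]
    congr 1
    ext ξ
    rw [smul_smul, ← Complex.exp_add, ← hF]
    congr 2
    simp
    ring
  rw [h2, abs_of_pos (by positivity), ← Complex.coe_smul] at hsub
  rw [hsub, smul_smul]
  push_cast
  rw [mul_inv_cancel₀, one_smul]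
  exact_mod_cast hpi

end C0Semigroup

/-! ### The semigroup orbits and the resolvent of the generator. -/

namespace C0Semigroup

variable {E : Type*} [NormedAddCommGroup E] [NormedSpace ℂ E]

theorem IsSG.norm_orbit_le {M ω : ℝ} {T : ℝ → E →L[ℂ] E} (hT : IsSG M ω T) (x : E) {t : ℝ}
    (ht : 0 ≤ t) : ‖T t x‖ ≤ M * ‖x‖ * Real.exp (ω * t) :=
  ((T t).le_of_opNorm_le (hT.norm_le t ht) x).trans_eq (by ring)

/-- Strong continuity of the semigroup. -/
theorem IsSG.continuousOn_orbit {M ω : ℝ} {T : ℝ → E →L[ℂ] E} (hT : IsSG M ω T) (x : E) :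
    ContinuousOn (fun t => T t x) (Ici 0) := by
  have hM : 0 ≤ M := zero_le_one.trans hT.one_le
  -- Factoring the smaller time out of the difference, `T(t) - T(s) = T(s)(T(t-s) - I)`, reduces
  -- both one-sided continuities to right continuity at `0`.
  have key : ∀ s t : ℝ, 0 ≤ s → s ≤ t →
      ‖T t x - T s x‖ ≤ M * Real.exp (ω * s) * ‖T (t - s) x - x‖ := by
    intro s t hs hst
    have h := hT.isC0Semigroup.map_add s (t - s) hs (sub_nonneg.2 hst)
    rw [add_sub_cancel] at h
    rw [h, ContinuousLinearMap.comp_apply, ← map_sub]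
    exact (T s).le_of_opNorm_le (hT.norm_le s hs) _
  intro t₀ ht₀
  have h0 : Tendsto (fun h : ℝ => ‖T |h| x - x‖) (𝓝 0) (𝓝 0) := by
    have h1 : Tendsto (fun h : ℝ => T h x) (𝓝[≥] 0) (𝓝 x) := by
      rw [← Ioi_insert, nhdsWithin_insert]
      refine Tendsto.sup ?_ (hT.isC0Semigroup.tendsto_zero x)
      rw [tendsto_pure_left]
      intro s hs
      simpa [hT.isC0Semigroup.map_zero] using mem_of_mem_nhds hs
    have h2 : Tendsto (fun h : ℝ => |h|) (𝓝 0) (𝓝[≥] 0) := by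
      refine tendsto_nhdsWithin_iff.2 ⟨?_, .of_forall fun h => abs_nonneg h⟩
      simpa using (continuous_abs (G := ℝ)).tendsto 0
    simpa using ((h1.comp h2).sub_const x).norm
  rw [ContinuousWithinAt, tendsto_iff_norm_sub_tendsto_zero]
  have h3 : Tendsto (fun t : ℝ => M * Real.exp (ω * t₀) * ‖T |t - t₀| x - x‖) (𝓝 t₀) (𝓝 0) := by
    have : Tendsto (fun t : ℝ => t - t₀) (𝓝 t₀) (𝓝 0) := by
      simpa using (continuous_sub_right t₀).tendsto t₀
    simpa using (h0.comp this).const_mul (M * Real.exp (ω * t₀))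
  refine squeeze_zero' (.of_forall fun _ => norm_nonneg _) ?_ (h3.mono_left nhdsWithin_le_nhds)
  filter_upwards [self_mem_nhdsWithin] with t ht
  rcases le_total t₀ t with h | h
  · rw [abs_of_nonneg (sub_nonneg.2 h)]
    exact key t₀ t ht₀ h
  · rw [norm_sub_rev, abs_sub_comm, abs_of_nonneg (sub_nonneg.2 h)]
    refine (key t t₀ ht h).trans ?_
    have := hT.nonneg
    gcongr

theorem IsSG.continuousOn_orbit_Ioi {M ω : ℝ} {T : ℝ → E →L[ℂ] E} (hT : IsSG M ω T) (x : E) :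
    ContinuousOn (fun t => T t x) (Ioi 0) :=
  (hT.continuousOn_orbit x).mono Ioi_subset_Ici_self

theorem IsSG.integrableOn_laplace_orbit {M ω : ℝ} {T : ℝ → E →L[ℂ] E} (hT : IsSG M ω T) (x : E)
    {z : ℂ} (hz : ω < z.re) :
    IntegrableOn (fun s : ℝ => Complex.exp (-(z * s)) • T s x) (Ioi 0) :=
  integrableOn_laplace (hT.continuousOn_orbit_Ioi x) (fun _ hs => hT.norm_orbit_le x hs.le) hz

theorem IsSG.exists_laplace_eq {M ω : ℝ} {T : ℝ → E →L[ℂ] E} (hT : IsSG M ω T)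
    {z : ℂ} (hz : ω < z.re) : ∃ R : E →L[ℂ] E, ∀ y, R y = laplace (fun s => T s y) z := by
  refine ⟨LinearMap.mkContinuous
    { toFun := fun y => laplace (fun s => T s y) z
      map_add' := fun x y => ?_
      map_smul' := fun c x => ?_ } (M / (z.re - ω)) fun y => ?_, fun y => rfl⟩
  · simp only [laplace, map_add, smul_add]
    exact integral_add (hT.integrableOn_laplace_orbit x hz) (hT.integrableOn_laplace_orbit y hz)
  · simp only [laplace, map_smul, RingHom.id_apply]
    rw [← integral_smul]
    simp only [smul_comm c]
  · refine (norm_laplace_le (fun s hs => hT.norm_orbit_le y hs.le) hz).trans_eq ?_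
    ring

theorem IsSG.orbit_comm {M ω : ℝ} {T : ℝ → E →L[ℂ] E} (hT : IsSG M ω T) (x : E) {s h : ℝ}
    (hs : 0 ≤ s) (hh : 0 ≤ h) : T h (T s x) = T s (T h x) := by
  rw [← ContinuousLinearMap.comp_apply, ← hT.isC0Semigroup.map_add h s hh hs, add_comm,
    hT.isC0Semigroup.map_add s h hs hh, ContinuousLinearMap.comp_apply]

variable [CompleteSpace E]

theorem IsSG.map_laplace {M ω : ℝ} {T : ℝ → E →L[ℂ] E} (hT : IsSG M ω T) (x : E) {z : ℂ}
    (hz : ω < z.re) (S : E →L[ℂ] E) :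
    S (laplace (fun s => T s x) z) = laplace (fun s => S (T s x)) z := by
  have h := S.integral_comp_comm (hT.integrableOn_laplace_orbit x hz)
  simp only [map_smul] at h
  exact h.symm

theorem IsSG.apply_laplace_comm {M ω : ℝ} {T : ℝ → E →L[ℂ] E} (hT : IsSG M ω T) (x : E) {z : ℂ}
    (hz : ω < z.re) {h : ℝ} (hh : 0 ≤ h) :
    T h (laplace (fun s => T s x) z) = laplace (fun s => T s (T h x)) z := by
  rw [hT.map_laplace x hz]
  refine setIntegral_congr_fun measurableSet_Ioi fun s hs => ?_
  simp only [hT.orbit_comm x (le_of_lt hs) hh]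

/-- `T(h)` shifts the orbit, and the substitution `s ↦ s - h` moves the shift into the factor
`e^{zh}` and the lower limit of integration. The dependence on `h` then becomes explicit and
differentiable from the right at `0`. -/
theorem IsSG.apply_laplace_eq {M ω : ℝ} {T : ℝ → E →L[ℂ] E} (hT : IsSG M ω T) (x : E) {z : ℂ}
    (hz : ω < z.re) {h : ℝ} (hh : 0 ≤ h) :
    T h (laplace (fun s => T s x) z) = Complex.exp (z * h) •
      (laplace (fun s => T s x) z - ∫ s in (0 : ℝ)..h, Complex.exp (-(z * s)) • T s x) := by
  have hi := hT.integrableOn_laplace_orbit x hz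
  have h1 := intervalIntegral.integral_Ioi_sub_Ioi hi hh
  rw [laplace, ← h1, sub_sub_cancel, ← laplace, hT.map_laplace x hz, laplace,
    ← (measurePreserving_add_right volume h).setIntegral_preimage_emb
      (MeasurableEquiv.addRight h).measurableEmbedding _ (Ioi h), ← integral_smul,
    preimage_add_const_Ioi, sub_self]
  refine setIntegral_congr_fun measurableSet_Ioi fun s hs => ?_
  rw [smul_smul, ← Complex.exp_add, add_comm s h,
    hT.isC0Semigroup.map_add h s hh (le_of_lt hs), ContinuousLinearMap.comp_apply]
  congr 2
  push_cast
  ring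

/-- Product rule at `h = 0` in `apply_laplace_eq`: the exponential contributes `z • v`, and the
integral over `[0, h]` contributes `-x`. -/
theorem IsSG.hasRightDeriv_laplace {M ω : ℝ} {T : ℝ → E →L[ℂ] E} (hT : IsSG M ω T) (x : E) {z : ℂ}
    (hz : ω < z.re) :
    HasRightDeriv T (laplace (fun s => T s x) z) (z • laplace (fun s => T s x) z - x) := by
  set v := laplace (fun s => T s x) z with hv
  have hc : ContinuousOn (fun s : ℝ => Complex.exp (-(z * s)) • T s x) (Ici 0) :=
    ContinuousOn.smul (by fun_prop) (hT.continuousOn_orbit x)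
  have hI : HasDerivWithinAt (fun h : ℝ => ∫ s in (0 : ℝ)..h, Complex.exp (-(z * s)) • T s x) x
      (Ici 0) 0 := by
    have := intervalIntegral.integral_hasDerivWithinAt_right (a := 0) (b := 0)
      (f := fun s : ℝ => Complex.exp (-(z * s)) • T s x) (s := Ici 0) (t := Ioi 0)
      IntervalIntegrable.refl
      ⟨Ioi 0, self_mem_nhdsWithin,
        (hc.mono Ioi_subset_Ici_self).aestronglyMeasurable measurableSet_Ioi⟩
      ((hc 0 self_mem_Ici).mono Ioi_subset_Ici_self)
    simpa [hT.isC0Semigroup.map_zero] using this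
  have hE : HasDerivWithinAt (fun h : ℝ => Complex.exp (z * h)) z (Ici 0) 0 := by
    have h1 : HasDerivAt (fun s : ℝ => (s : ℂ)) 1 0 := Complex.ofRealCLM.hasDerivAt
    simpa using (h1.const_mul z).cexp.hasDerivWithinAt (s := Ici 0)
  have hD := hE.smul ((hasDerivWithinAt_const (0 : ℝ) (Ici 0) v).sub hI)
  have hD' := (hasDerivWithinAt_iff_tendsto_slope.1 hD)
  have hset : Ici (0 : ℝ) \ {0} = Ioi 0 := Ici_sdiff_left
  rw [hset] at hD'
  have hlim : Complex.exp (z * (0 : ℝ)) • ((0 : E) - x) + z • (v - ∫ s in (0 : ℝ)..0,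
      Complex.exp (-(z * s)) • T s x) = z • v - x := by
    simp; abel
  refine (hlim ▸ hD' : Tendsto _ _ (𝓝 (z • v - x))).congr' ?_
  filter_upwards [self_mem_nhdsWithin] with h hh
  rw [hv, hT.apply_laplace_eq x hz (le_of_lt hh), ← hv, slope_def_module, sub_zero,
    ← Complex.coe_smul]
  simp

/-- The Laplace transform of the semigroup is the resolvent of its generator. -/
theorem IsSG.exists_isResolventAt {M ω : ℝ} {T : ℝ → E →L[ℂ] E} (hT : IsSG M ω T) {z : ℂ}
    (hz : ω < z.re) : ∃ R : E →L[ℂ] E, IsResolventAt (generator T) z R ∧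
      ∀ y, R y = laplace (fun s => T s y) z := by
  obtain ⟨R, hR⟩ := hT.exists_laplace_eq hz
  have hder (y : E) : HasRightDeriv T (R y) (z • R y - y) := by
    simpa only [hR] using hT.hasRightDeriv_laplace y hz
  refine ⟨R, ⟨fun y => ?_, fun x => ?_⟩, hR⟩
  · have hm : R y ∈ (generator T).domain := ⟨_, hder y⟩
    refine ⟨hm, ?_⟩
    rw [(generator_spec ⟨R y, hm⟩).unique (hder y), sub_sub_cancel]
  -- `R` is continuous and commutes with `T(h)`, so the right derivative at `R x` is also `R (A x)`;
  -- comparison with `z • R x - x` gives the left inverse identity.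
  · have h1 : HasRightDeriv T (R x) (R (generator T x)) := by
      refine ((R.continuous.tendsto _).comp (generator_spec x)).congr' ?_
      filter_upwards [self_mem_nhdsWithin] with h hh
      simp only [Function.comp_apply, map_smul, map_sub]
      rw [hR x, hT.apply_laplace_comm _ hz (le_of_lt hh), hR]
    rw [map_sub, map_smul, h1.unique (hder x), sub_sub_cancel]

theorem IsSG.mem_resolventSet {M ω : ℝ} {T : ℝ → E →L[ℂ] E} (hT : IsSG M ω T) {z : ℂ}
    (hz : ω < z.re) : z ∈ resolventSet (generator T) :=
  (hT.exists_isResolventAt hz).imp fun _ h => h.1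

theorem IsSG.resolvent_apply {M ω : ℝ} {T : ℝ → E →L[ℂ] E} (hT : IsSG M ω T) {z : ℂ}
    (hz : ω < z.re) (y : E) : resolvent (generator T) z y = laplace (fun s => T s y) z := by
  obtain ⟨R, h, hR⟩ := hT.exists_isResolventAt hz
  rw [(isResolventAt_resolvent (hT.mem_resolventSet hz)).unique h, hR]

/-- `R(z) x = z⁻¹ x + z⁻¹ R(z) A x` for `x ∈ D(A)`. -/
theorem IsSG.laplace_orbit_eq {M ω : ℝ} {T : ℝ → E →L[ℂ] E} (hT : IsSG M ω T) {z : ℂ}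
    (hz : ω < z.re) (x : (generator T).domain) :
    laplace (fun s => T s x) z = z⁻¹ • ((x : E) + laplace (fun s => T s (generator T x)) z) := by
  obtain ⟨R, h, hR⟩ := hT.exists_isResolventAt hz
  have h0 : z ≠ 0 := by
    rintro rfl
    exact absurd hz (by simpa using hT.nonneg)
  have h1 := h.2 x
  rw [map_sub, map_smul, sub_eq_iff_eq_add] at h1
  rw [← hR, ← hR, eq_inv_smul_iff₀ h0, h1]

end C0Semigroup

/-! ### Inversion integrals along a vertical line. -/

namespace C0Semigroup

variable {E : Type*} [NormedAddCommGroup E] [NormedSpace ℂ E]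

theorem line_ne_zero {a : ℝ} (ha : 0 < a) (τ : ℝ) : (a : ℂ) + τ * Complex.I ≠ 0 := by
  intro h
  have := congrArg Complex.re h
  simp at this
  exact ha.ne' this

theorem norm_exp_line_mul (a τ t : ℝ) :
    ‖Complex.exp ((a + τ * Complex.I) * t)‖ = Real.exp (a * t) := by
  simp [Complex.norm_exp]

theorem integrable_inv_line_sq {a : ℝ} (ha : 0 < a) :
    Integrable fun τ : ℝ => (((a : ℂ) + τ * Complex.I) ^ 2)⁻¹ := by
  -- The constant comes from `1 + τ² ≤ (1 + a⁻²)(a² + τ²)`.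
  refine Integrable.mono' (integrable_inv_one_add_sq.const_mul (1 + (a ^ 2)⁻¹)) ?_ ?_
  · refine Continuous.aestronglyMeasurable ?_
    exact Continuous.inv₀ (by fun_prop) fun τ => pow_ne_zero 2 (line_ne_zero ha τ)
  · refine .of_forall fun τ => ?_
    rw [norm_inv, norm_pow, ← Complex.normSq_eq_norm_sq, Complex.normSq_add_mul_I,
      ← div_eq_mul_inv, le_div_iff₀ (by positivity), inv_mul_le_iff₀ (by positivity)]
    have : (a ^ 2 + τ ^ 2) * (1 + (a ^ 2)⁻¹) = 1 + τ ^ 2 + (a ^ 2 + τ ^ 2 * (a ^ 2)⁻¹) := by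
      field_simp
      ring
    rw [this]
    have : 0 ≤ a ^ 2 + τ ^ 2 * (a ^ 2)⁻¹ := by positivity
    linarith

/-- Absolutely convergent inversion integrals converge uniformly for bounded `t`. -/
theorem tendstoUniformlyOn_exp_smul {g : ℝ → E} (hg : Integrable g) {a K : ℝ} (ha : 0 ≤ a)
    {S : Set ℝ} (hS : ∀ t ∈ S, t ≤ K) :
    TendstoUniformlyOn
      (fun (p : ℝ × ℝ) (t : ℝ) =>
        ∫ τ in (-p.1)..p.2, Complex.exp ((a + τ * Complex.I) * t) • g τ)
      (fun t => ∫ τ : ℝ, Complex.exp ((a + τ * Complex.I) * t) • g τ) (atTop ×ˢ atTop) S := by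
  have hlim : Tendsto (fun p : ℝ × ℝ => Real.exp (a * K) *
      ((∫ τ, ‖g τ‖) - ∫ τ in (-p.1)..p.2, ‖g τ‖)) (atTop ×ˢ atTop) (𝓝 0) := by
    have := intervalIntegral_tendsto_integral hg.norm
      (tendsto_neg_atTop_atBot.comp tendsto_fst : Tendsto (fun p : ℝ × ℝ => -p.1)
        (atTop ×ˢ atTop) atBot)
      (tendsto_snd : Tendsto (fun p : ℝ × ℝ => p.2) (atTop ×ˢ atTop) atTop)
    simpa using (this.const_sub (∫ τ, ‖g τ‖)).const_mul (Real.exp (a * K))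
  have hi (t : ℝ) : Integrable fun τ : ℝ => Complex.exp ((a + τ * Complex.I) * t) • g τ := by
    refine hg.bdd_smul ?_ (.of_forall fun τ => ?_) (C := Real.exp (a * t))
    · exact Continuous.aestronglyMeasurable (by fun_prop)
    · exact (norm_exp_line_mul a τ t).le
  rw [Metric.tendstoUniformlyOn_iff]
  intro ε hε
  filter_upwards [hlim.eventually (gt_mem_nhds hε),
    (tendsto_fst : Tendsto Prod.fst (atTop ×ˢ atTop) (atTop : Filter ℝ)).eventually_ge_atTop 0,
    (tendsto_snd : Tendsto Prod.snd (atTop ×ˢ atTop) (atTop : Filter ℝ)).eventually_ge_atTop 0]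
    with p hp h1 h2 t ht
  refine lt_of_le_of_lt ?_ hp
  have hle : -p.1 ≤ p.2 := by linarith
  -- The error is the integral over the complement of the segment, dominated by `e^{aK}` times the
  -- tail of `‖g‖`, a bound independent of `t`.
  rw [dist_eq_norm, intervalIntegral.integral_of_le hle, intervalIntegral.integral_of_le hle,
    ← integral_add_compl measurableSet_Ioc (hi t), add_sub_cancel_left,
    ← integral_add_compl measurableSet_Ioc hg.norm, add_sub_cancel_left, ← integral_const_mul]
  refine norm_integral_le_of_norm_le (hg.norm.integrableOn.const_mul _) (.of_forall fun τ => ?_)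
  rw [norm_smul, norm_exp_line_mul]
  have := hS t ht
  gcongr

/-- Integration by parts: the `τ`-derivative of `e^{zt}/z` is `i(t e^{zt}/z - e^{zt}/z²)`. One power
of decay is gained at the cost of a factor `t⁻¹`. -/
theorem integral_exp_div_line {a t : ℝ} (ha : 0 < a) (ht : t ≠ 0) (r s : ℝ) :
    ∫ τ in r..s, Complex.exp ((a + τ * Complex.I) * t) / (a + τ * Complex.I) =
      (t : ℂ)⁻¹ * (-Complex.I *
        (Complex.exp ((a + s * Complex.I) * t) / (a + s * Complex.I) -
          Complex.exp ((a + r * Complex.I) * t) / (a + r * Complex.I)) +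
        ∫ τ in r..s, Complex.exp ((a + τ * Complex.I) * t) • ((a + τ * Complex.I) ^ 2)⁻¹) := by
  have ht' : (t : ℂ) ≠ 0 := by exact_mod_cast ht
  have hc1 : Continuous fun τ : ℝ =>
      Complex.exp ((a + τ * Complex.I) * t) / ((a : ℂ) + τ * Complex.I) :=
    Continuous.div (by fun_prop) (by fun_prop) (line_ne_zero ha)
  have hc2 : Continuous fun τ : ℝ =>
      Complex.exp ((a + τ * Complex.I) * t) • (((a : ℂ) + τ * Complex.I) ^ 2)⁻¹ :=
    Continuous.smul
      (f := fun τ : ℝ => Complex.exp ((a + τ * Complex.I) * t)) (by fun_prop)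
      (Continuous.inv₀ (by fun_prop) fun τ => pow_ne_zero 2 (line_ne_zero ha τ))
  have hd (τ : ℝ) : HasDerivAt (fun τ : ℝ =>
      Complex.exp ((a + τ * Complex.I) * t) / ((a : ℂ) + τ * Complex.I))
      (Complex.I * (t * (Complex.exp ((a + τ * Complex.I) * t) / (a + τ * Complex.I)) -
        Complex.exp ((a + τ * Complex.I) * t) • ((a + τ * Complex.I) ^ 2)⁻¹)) τ := by
    have h1 : HasDerivAt (fun τ : ℝ => (a : ℂ) + τ * Complex.I) (1 * Complex.I) τ :=
      ((Complex.ofRealCLM.hasDerivAt (x := τ)).mul_const Complex.I).const_add (a : ℂ)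
    refine ((h1.mul_const (t : ℂ)).cexp.div h1 (line_ne_zero ha τ)).congr_deriv ?_
    have := line_ne_zero ha τ
    rw [smul_eq_mul]
    field_simp
  have h := intervalIntegral.integral_eq_sub_of_hasDerivAt (a := r) (b := s) (fun τ _ => hd τ)
    (Continuous.intervalIntegrable
      (continuous_const.mul ((continuous_const.mul hc1).sub hc2)) _ _)
  rw [intervalIntegral.integral_const_mul, intervalIntegral.integral_sub
    ((hc1.intervalIntegrable _ _).const_mul _) (hc2.intervalIntegrable _ _),
    intervalIntegral.integral_const_mul] at h
  rw [← h, eq_inv_mul_iff_mul_eq₀ ht', ← mul_assoc, neg_mul, Complex.I_mul_I]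
  ring

theorem norm_exp_div_line_le {a t K s : ℝ} (ha : 0 < a) (ht : t ≤ K) (hs : 0 < |s|) :
    ‖Complex.exp ((a + s * Complex.I) * t) / (a + s * Complex.I)‖ ≤ Real.exp (a * K) / |s| := by
  rw [norm_div, norm_exp_line_mul]
  have h : |s| ≤ ‖(a : ℂ) + s * Complex.I‖ := by
    simpa using Complex.abs_im_le_norm ((a : ℂ) + s * Complex.I)
  gcongr

theorem tendstoUniformlyOn_mul_left {ι : Type*} {l : Filter ι} {F : ι → ℝ → ℂ} {f c : ℝ → ℂ}
    {S : Set ℝ} {C : ℝ} (h : TendstoUniformlyOn F f l S) (hc : ∀ t ∈ S, ‖c t‖ ≤ C) :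
    TendstoUniformlyOn (fun i t => c t * F i t) (fun t => c t * f t) l S := by
  rw [Metric.tendstoUniformlyOn_iff] at h ⊢
  intro ε hε
  have hC : 0 < |C| + 1 := by positivity
  filter_upwards [h (ε / (|C| + 1)) (by positivity)] with i hi t ht
  rw [dist_eq_norm, ← mul_sub, norm_mul, ← dist_eq_norm]
  have h1 := hi t ht
  rw [lt_div_iff₀ hC] at h1
  have h2 : ‖c t‖ ≤ |C| + 1 := (hc t ht).trans ((le_abs_self C).trans (by linarith))
  calc ‖c t‖ * dist (f t) (F i t) ≤ (|C| + 1) * dist (f t) (F i t) := by gcongr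
    _ < ε := by rwa [mul_comm]

/-- The conditionally convergent integral `∫ e^{zt} z⁻¹ dz` over a line in the right half plane. -/
theorem tendstoUniformlyOn_exp_div_line {a δ K : ℝ} (ha : 0 < a) (hδ : 0 < δ) :
    TendstoUniformlyOn
      (fun (p : ℝ × ℝ) (t : ℝ) =>
        ∫ τ in (-p.1)..p.2, Complex.exp ((a + τ * Complex.I) * t) / (a + τ * Complex.I))
      (fun _ => (2 * Real.pi : ℂ)) (atTop ×ˢ atTop) (Icc δ K) := by
  have hre (τ : ℝ) : ((a : ℂ) + τ * Complex.I).re = a := by simp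
  have hid (τ : ℝ) : laplace (fun s => (s : ℂ)) (a + τ * Complex.I) =
      (((a : ℂ) + τ * Complex.I) ^ 2)⁻¹ := laplace_id (by rwa [hre])
  have hval : ∀ t ∈ Icc δ K, ∫ τ : ℝ, Complex.exp ((a + τ * Complex.I) * t) •
      (((a : ℂ) + τ * Complex.I) ^ 2)⁻¹ = 2 * Real.pi * t := by
    intro t ht
    have := integral_exp_smul_laplace (f := fun s => (s : ℂ)) (a := a) (b := a / 2) (by fun_prop)
      (fun _ hs => norm_ofReal_le_exp (half_pos ha) hs) (half_lt_self ha)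
      (by simpa only [hid] using integrable_inv_line_sq ha) (hδ.trans_le ht.1)
    simpa only [hid, smul_eq_mul] using this
  have h1 := tendstoUniformlyOn_exp_smul (integrable_inv_line_sq ha) ha.le
    (S := Icc δ K) (K := K) fun t ht => ht.2
  -- The boundary terms are at most `e^{aK}/|τ|` at each endpoint `a + iτ`.
  have h2 : TendstoUniformlyOn (fun (p : ℝ × ℝ) (t : ℝ) => -Complex.I *
        (Complex.exp ((a + (p.2 : ℝ) * Complex.I) * t) / (a + (p.2 : ℝ) * Complex.I) -
          Complex.exp ((a + (-p.1 : ℝ) * Complex.I) * t) / (a + (-p.1 : ℝ) * Complex.I)))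
      (fun _ => (0 : ℂ)) (atTop ×ˢ atTop) (Icc δ K) := by
    have hlim : Tendsto (fun p : ℝ × ℝ => Real.exp (a * K) / |p.2| + Real.exp (a * K) / |-p.1|)
        (atTop ×ˢ atTop) (𝓝 0) := by
      have h := tendsto_const_nhds (x := Real.exp (a * K)) (f := atTop)|>.div_atTop
        tendsto_abs_atTop_atTop
      simpa using (h.comp tendsto_snd).add (h.comp tendsto_fst)
    rw [Metric.tendstoUniformlyOn_iff]
    intro ε hε
    filter_upwards [hlim.eventually (gt_mem_nhds hε),
      (tendsto_fst : Tendsto Prod.fst (atTop ×ˢ atTop) (atTop : Filter ℝ)).eventually_gt_atTop 0,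
      (tendsto_snd : Tendsto Prod.snd (atTop ×ˢ atTop) (atTop : Filter ℝ)).eventually_gt_atTop 0]
      with p hp hp1 hp2 t ht
    rw [dist_zero_left, norm_mul, norm_neg, Complex.norm_I, one_mul]
    refine lt_of_le_of_lt ((norm_sub_le _ _).trans (add_le_add ?_ ?_)) hp
    · exact norm_exp_div_line_le ha ht.2 (abs_pos.2 hp2.ne')
    · exact norm_exp_div_line_le ha ht.2 (abs_pos.2 (neg_ne_zero.2 hp1.ne'))
  -- The lower bound `δ ≤ t` keeps the factor `t⁻¹` bounded.
  have h3 := tendstoUniformlyOn_mul_left (c := fun t : ℝ => (t : ℂ)⁻¹) (C := δ⁻¹) (h2.add h1)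
    fun t ht => by
      rw [norm_inv, Complex.norm_real, Real.norm_of_nonneg (hδ.le.trans ht.1)]
      exact inv_anti₀ hδ ht.1
  refine (h3.congr (.of_forall fun p t ht => ?_)).congr_right fun t ht => ?_
  · exact (integral_exp_div_line ha (hδ.trans_le ht.1).ne' _ _).symm
  · have ht' : (t : ℂ) ≠ 0 := by exact_mod_cast (hδ.trans_le ht.1).ne'
    simp only [Pi.add_apply]
    rw [hval t ht]
    field_simp
    simp

/-! ### Inversion for the semigroup on `D(A²)`. -/

variable {M ω : ℝ} {T : ℝ → E →L[ℂ] E}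

theorem IsSG.norm_orbit_sub_le (hT : IsSG M ω T) (x : E) {s : ℝ} (hs : 0 < s) :
    ‖T s x - x‖ ≤ (M * ‖x‖ + ‖x‖) * Real.exp (ω * s) := by
  have h1 : 1 ≤ Real.exp (ω * s) := Real.one_le_exp (mul_nonneg hT.nonneg hs.le)
  calc ‖T s x - x‖ ≤ ‖T s x‖ + ‖x‖ := norm_sub_le _ _
    _ ≤ M * ‖x‖ * Real.exp (ω * s) + ‖x‖ * Real.exp (ω * s) :=
      add_le_add (hT.norm_orbit_le x hs.le) (le_mul_of_one_le_right (norm_nonneg x) h1)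
    _ = _ := by ring

variable [CompleteSpace E]

theorem IsSG.laplace_orbit_sub (hT : IsSG M ω T) (x : E) {z : ℂ} (hz : ω < z.re) :
    laplace (fun s => T s x - x) z = laplace (fun s => T s x) z - z⁻¹ • x := by
  have h0 : 0 < z.re := hT.nonneg.trans_lt hz
  have h1 : IntegrableOn (fun s : ℝ => Complex.exp (-(z * s)) • (1 : ℂ)) (Ioi 0) :=
    integrableOn_laplace (C := 1) (b := 0) (by fun_prop) (by simp) h0
  simp only [smul_eq_mul, mul_one] at h1
  have h2 := laplace_one h0
  simp only [laplace, smul_eq_mul, mul_one] at h2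
  simp only [laplace, smul_sub]
  rw [integral_sub (hT.integrableOn_laplace_orbit x hz) (h1.smul_const x), integral_smul_const, h2]

/-- Two uses of `laplace_orbit_eq` cancel `x/z` and leave `z⁻²(Ax + R(z)A²x)`, with `‖R(z)A²x‖ ≤
M‖A²x‖/(a - ω)` on the line. -/
theorem IsSG.integrable_laplace_orbit_sub (hT : IsSG M ω T) {a : ℝ} (ha : ω < a) {x : E}
    (hx : x ∈ sqDomain (generator T)) :
    Integrable fun τ : ℝ => laplace (fun s => T s x - x) (a + τ * Complex.I) := by
  obtain ⟨hx1, hx2⟩ := hx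
  set y := generator T ⟨x, hx1⟩ with hy
  set w := generator T ⟨y, hx2⟩ with hw
  have hre (τ : ℝ) : ((a : ℂ) + τ * Complex.I).re = a := by simp
  refine Integrable.mono' ((integrable_inv_line_sq (hT.nonneg.trans_lt ha)).norm.mul_const
    (‖y‖ + M * ‖w‖ / (a - ω))) ?_ (.of_forall fun τ => ?_)
  · refine (continuous_laplace_line ?_ (fun s hs => hT.norm_orbit_sub_le x hs)
      ha).aestronglyMeasurable
    exact (hT.continuousOn_orbit_Ioi x).sub continuousOn_const
  · have hz : ω < ((a : ℂ) + τ * Complex.I).re := by rwa [hre]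
    have e1 := hT.laplace_orbit_eq hz ⟨x, hx1⟩
    have e2 := hT.laplace_orbit_eq hz ⟨y, hx2⟩
    simp only [← hy, ← hw] at e1 e2
    rw [hT.laplace_orbit_sub x hz, e1, smul_add, add_sub_cancel_left, e2, smul_smul, ← mul_inv,
      ← sq, norm_smul]
    gcongr
    refine (norm_add_le _ _).trans (add_le_add_right ?_ _)
    have := norm_laplace_le (fun s hs => hT.norm_orbit_le w (le_of_lt hs)) hz
    rwa [hre] at this

theorem IsSG.hasLineIntegralUniformlyOn (hT : IsSG M ω T) {a : ℝ} (ha : ω < a) {x : E}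
    (hx : x ∈ sqDomain (generator T)) {δ K : ℝ} (hδ : 0 < δ) :
    HasLineIntegralUniformlyOn
      (fun t z => Complex.exp (z * t) • resolvent (generator T) z x) a
      (fun t => (2 * (Real.pi : ℂ) * Complex.I) • T t x) (Icc δ K) := by
  have hre (τ : ℝ) : ((a : ℂ) + τ * Complex.I).re = a := by simp
  have hR (τ : ℝ) : resolvent (generator T) (a + τ * Complex.I) x =
      laplace (fun s => T s x) (a + τ * Complex.I) := hT.resolvent_apply (by rwa [hre]) x
  have ha0 : 0 < a := hT.nonneg.trans_lt ha
  have hk : ContinuousOn (fun s => T s x - x) (Ioi 0) :=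
    (hT.continuousOn_orbit_Ioi x).sub continuousOn_const
  have hkb : ∀ s, 0 < s → ‖T s x - x‖ ≤ (M * ‖x‖ + ‖x‖) * Real.exp (ω * s) :=
    fun s hs => hT.norm_orbit_sub_le x hs
  have hkc := continuous_laplace_line hk hkb ha
  have hL := hT.integrable_laplace_orbit_sub ha hx
  refine ⟨fun t _ r s => ?_, ?_⟩
  · refine Continuous.intervalIntegrable ?_ _ _
    simp only [hR]
    have := continuous_laplace_line (hT.continuousOn_orbit_Ioi x)
      (fun s hs => hT.norm_orbit_le x (le_of_lt hs)) ha
    exact Continuous.smul (by fun_prop) this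
  · have h1 := (ContinuousLinearMap.toSpanSingleton ℂ x).uniformContinuous.comp_tendstoUniformlyOn
      (tendstoUniformlyOn_exp_div_line (K := K) ha0 hδ)
    have h2 := tendstoUniformlyOn_exp_smul hL ha0.le (S := Icc δ K) (K := K) fun t ht => ht.2
    -- The factor `i` is `dz = i dτ`; the limit is `i(2πx + 2π(T(t)x - x))`.
    have h3 := (uniformContinuous_const_smul Complex.I).comp_tendstoUniformlyOn (h1.add h2)
    refine (h3.congr (.of_forall fun p t ht => ?_)).congr_right fun t ht => ?_
    · have hc1 : Continuous fun τ : ℝ =>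
          Complex.exp ((a + τ * Complex.I) * t) / ((a : ℂ) + τ * Complex.I) :=
        Continuous.div (by fun_prop) (by fun_prop) (line_ne_zero ha0)
      simp only [Function.comp_apply, Pi.add_apply, ContinuousLinearMap.toSpanSingleton_apply,
        segmentIntegral]
      rw [intervalIntegral.integral_smul, ← intervalIntegral.integral_smul_const,
        ← intervalIntegral.integral_add]
      · congr 2
        ext τ
        rw [hR, hT.laplace_orbit_sub x (by rwa [hre]), smul_sub, smul_smul, div_eq_mul_inv]
        abel
      · exact Continuous.intervalIntegrable (by fun_prop) _ _
      · refine Continuous.intervalIntegrable ?_ _ _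
        exact Continuous.smul (by fun_prop) hkc
    · simp only [Function.comp_apply, Pi.add_apply, ContinuousLinearMap.toSpanSingleton_apply]
      rw [integral_exp_smul_laplace hk hkb ha hL (hδ.trans_le ht.1), ← smul_add, smul_smul,
        add_sub_cancel, mul_comm]

end C0Semigroup

theorem mainTheorem9 {E : Type*} [NormedAddCommGroup E] [NormedSpace ℂ E] [CompleteSpace E]
    (M ω : ℝ) (T : ℝ → E →L[ℂ] E) (hT : C0Semigroup.IsSG M ω T) (lam : ℂ) (hlam : ω < lam.re) :
    (∀ z : ℂ, z.re = lam.re → z ∈ C0Semigroup.resolventSet (C0Semigroup.generator T)) ∧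
    ∀ x ∈ C0Semigroup.sqDomain (C0Semigroup.generator T), ∃ J : ℝ → E,
      (∀ t : ℝ, 0 < t →
        C0Semigroup.HasLineIntegral
          (fun z => Complex.exp (z * t) • C0Semigroup.resolvent (C0Semigroup.generator T) z x)
          lam.re (J t) ∧
        T t x = (1 / (2 * (Real.pi : ℂ) * Complex.I)) • J t) ∧
      ∀ δ : ℝ, 0 < δ →
        C0Semigroup.HasLineIntegralUniformlyOn
          (fun t z => Complex.exp (z * t) • C0Semigroup.resolvent (C0Semigroup.generator T) z x)
          lam.re J (Icc δ (1 / δ)) := by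
  refine ⟨fun z hz => hT.mem_resolventSet (hz ▸ hlam), fun x hx =>
    ⟨fun t => (2 * (Real.pi : ℂ) * Complex.I) • T t x, fun t ht => ?_, fun δ hδ =>
      hT.hasLineIntegralUniformlyOn hlam hx hδ⟩⟩
  -- Pointwise convergence at `t` is uniform convergence on the degenerate interval `[t, t]`.
  have h := hT.hasLineIntegralUniformlyOn (K := t) hlam hx ht
  have hmem : t ∈ Icc t t := ⟨le_rfl, le_rfl⟩
  refine ⟨⟨h.1 t hmem, h.2.tendsto_at hmem⟩, ?_⟩
  rw [one_div, inv_smul_smul₀ Complex.two_pi_I_ne_zero]
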